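/- Let $A\in\mathbb Z^{d\times n}$, $u\in\mathbb Z^n$, $b\in\mathbb Z^d$, $c\in\mathbb Q^n$, $c_1,\dots,c_s\in\mathbb Q^n$, let $C$ be the $s\times n$ matrix with rows $c_1,\dots,c_s$, and let $F=\{z\in\mathbb Z^n: Az=b,\ 0\le z\le u\}$. Assume that $c_i^\top z\in\mathbb Z$ for all $z\in F$ and $i=1,\dots,s$ (automatic if $c_i\in\mathbb Z^n$). Let $\bar f(z)=f(c^\top z,c_1^\top z,\dots,c_s^\top z)$, where $f(y_0,\dots,y_s)=y_0+\sum_{i=1}^s f_i(y_i)$ and each $f_i:\mathbb Z\to\mathbb Z$ is $\mathbb Z$-convex, that is, $f_i(\lambda x+(1-\lambda)y)\le\lambda f_i(x)+(1-\lambda)f_i(y)$ whenever $x,y\in\mathbb Z$, $0\le\lambda\le1$ and $\lambda x+(1-\lambda)y\in\mathbb Z$. (The functions $f_i$ may be given merely by a comparison oracle for $f$; only augmentation steps are counted below.) Let $H\in\mathbb Q$ satisfy $\bar f(x)-\bar f(y)\le H$ for all $x,y\in F$, and assume that the encoding length of $H$ is at most $p(L)$, where $p$ is a fixed polynomial and $L$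 is the total binary encoding length of $A,u,b,c,c_1,\dots,c_s$. For a rational matrix $M$ with $N$ columns, the Graver basis $\mathcal G(M)$ is the union, over the $2^N$ closed orthants $\mathbb O$ of $\mathbb R^N$, of the nonzero elements of the unique inclusion-minimal set generating $\ker(M)\cap\mathbb O\cap\mathbb Z^N$ over $\mathbb Z_+$. Let $\mathcal G(A,C)$ be the projection of $\mathcal G\left(\begin{smallmatrix}A&0\\ C&I_s\end{smallmatrix}\right)$ onto the first $n$ coordinates. A greedy augmentation vector for $z\in F$ is an optimal solution $\alpha g$ of $$\min\{\bar f(z+\alpha g):\ \alpha\in\mathbb R_+,\ g\in\mathcal G(A,C)\cup\{0\},\ z+\alpha g\in F\}.$$ Starting from $z^0\in F$, the greedy procedure repeats the following: if $0$ is a greedy augmentation vector for the current point, return this point; otherwise choose any greedy augmentation vector $\alpha g$ for the current point and add it to the point. Then for every polynomial $p$ there is a polynomial $q$, depending only on $p$, such that for all data as above and every $z^0\in F$ the procedure can always be carried out, terminates after at most $q(L')$ augmentation steps, where $L'$ is the total binary encoding length of $A,u,b,c,c_1,\dots,c_s,z^0$, and returns an optimal solution of $\min\{\bar f(z): z\in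 F\}$. Moreover, for any sequence of points produced from $z^0$ by adding greedy augmentation vectors, with ties (also with $0$) broken arbitrarily, all points after $q(L')$ or more steps are optimal, and any point for which $0$ is a greedy augmentation vector is optimal. -/

import Mathlib

/-- The integer points of `ker M ∩ O_σ`, where `O_σ` is the orthant with sign vector `σ`. -/
def kerOrthant {κ ι : Type*} [Fintype ι] (M : Matrix κ ι ℚ) (σ : ι → ℤˣ) : Set (ι → ℤ) :=
  {z | M.mulVec (fun j => (z j : ℚ)) = 0 ∧ ∀ j, 0 ≤ (σ j : ℤ) * z j}

/-- `H` is an inclusion-minimal set generating `T` over the nonnegative integers. -/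
def IsHilbertBasis {ι : Type*} (T H : Set (ι → ℤ)) : Prop :=
  Minimal (fun K : Set (ι → ℤ) => (AddSubmonoid.closure K : Set (ι → ℤ)) = T) H

/-- The Graver basis of `M`: the union, over all orthants, of the nonzero elements of the
minimal generating set of the integer points of `ker M` in that orthant. -/
def graverBasis {κ ι : Type*} [Fintype ι] (M : Matrix κ ι ℚ) : Set (ι → ℤ) :=
  {g | g ≠ 0 ∧ ∃ (σ : ι → ℤˣ) (H : Set (ι → ℤ)), IsHilbertBasis (kerOrthant M σ) H ∧ g ∈ H}

/-- `G(A, C)`: the Graver basis of the block matrix with rows `(A 0)` and `(C I)`, projected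
onto the first `n` variables. -/
def projGraverBasis {d n s : ℕ} (A : Matrix (Fin d) (Fin n) ℤ) (C : Matrix (Fin s) (Fin n) ℚ) :
    Set (Fin n → ℤ) :=
  (fun (g : Fin n ⊕ Fin s → ℤ) (j : Fin n) => g (Sum.inl j)) ''
    graverBasis (Matrix.fromBlocks (A.map (Int.cast : ℤ → ℚ)) 0 C 1)

/-- Convexity of a function on the integers. -/
def ZConvex (g : ℤ → ℤ) : Prop :=
  ∀ (x y w : ℤ) (t : ℝ), 0 ≤ t → t ≤ 1 → (w : ℝ) = t * x + (1 - t) * y →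
    (g w : ℝ) ≤ t * g x + (1 - t) * g y

/-- The separable function `f(y₀, y₁, …, yₛ) = ∑ i, fᵢ(yᵢ) + y₀`. -/
def sepFun {s : ℕ} (f : Fin s → ℤ → ℤ) (y₀ : ℚ) (y : Fin s → ℤ) : ℚ :=
  ∑ i, (f i (y i) : ℚ) + y₀

/-- `c ⬝ z` for a rational vector `c` and an integer vector `z`. -/
def ratDot {n : ℕ} (c : Fin n → ℚ) (z : Fin n → ℤ) : ℚ :=
  ∑ j, c j * (z j : ℚ)

/-- The objective `z ↦ f(c ⬝ z, c₁ ⬝ z, …, cₛ ⬝ z)`, where `cᵢ` is row `i` of `C`. It is only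
used at points where all `cᵢ ⬝ z` are integers, so that the floor does not change them. -/
def objective {n s : ℕ} (f : Fin s → ℤ → ℤ) (c : Fin n → ℚ) (C : Matrix (Fin s) (Fin n) ℚ)
    (z : Fin n → ℤ) : ℚ :=
  sepFun f (ratDot c z) (fun i => ⌊ratDot (C i) z⌋)

/-- The feasible set `{z : A z = b, 0 ≤ z ≤ u, z integer}`. -/
def feasibleSet {d n : ℕ} (A : Matrix (Fin d) (Fin n) ℤ) (b : Fin d → ℤ) (u : Fin n → ℤ) :
    Set (Fin n → ℤ) :=
  {z | A.mulVec z = b ∧ 0 ≤ z ∧ z ≤ u}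

/-- `z` is an optimal solution of `min {φ(w) : w ∈ F}`. -/
def IsOptimal {n : ℕ} (F : Set (Fin n → ℤ)) (φ : (Fin n → ℤ) → ℚ) (z : Fin n → ℤ) : Prop :=
  z ∈ F ∧ ∀ w ∈ F, φ z ≤ φ w

/-- `v` is a candidate step at `z`: `v = α g` with `α` a nonnegative real, `g ∈ S`, and
`z + v ∈ F`. -/
def IsCandidate {n : ℕ} (F S : Set (Fin n → ℤ)) (z v : Fin n → ℤ) : Prop :=
  (∃ α : ℝ, 0 ≤ α ∧ ∃ g ∈ S, ∀ j, (v j : ℝ) = α * (g j : ℝ)) ∧ z + v ∈ F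

/-- `v` is a greedy augmentation vector from `S` for `z`: an optimal solution `α g` of
`min {φ(z + α g) : α ≥ 0, g ∈ S, z + α g ∈ F}`. -/
def IsGreedyVector {n : ℕ} (F : Set (Fin n → ℤ)) (φ : (Fin n → ℤ) → ℚ) (S : Set (Fin n → ℤ))
    (z v : Fin n → ℤ) : Prop :=
  IsCandidate F S z v ∧ ∀ w, IsCandidate F S z w → φ (z + v) ≤ φ (z + w)

/-- `z 0, …, z k` arise by `k` successive additions of greedy augmentation vectors, with an
arbitrary choice among several greedy augmentation vectors. -/
def IsGreedySequence {n : ℕ} (F : Set (Fin n → ℤ)) (φ : (Fin n → ℤ) → ℚ)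
    (S : Set (Fin n → ℤ)) (z : ℕ → Fin n → ℤ) (k : ℕ) : Prop :=
  ∀ i < k, ∃ v, IsGreedyVector F φ S (z i) v ∧ z (i + 1) = z i + v

/-- The first `k` augmentation steps of an execution of the greedy procedure, which returns
the current point as soon as `0` is a greedy augmentation vector for it. -/
def IsGreedyExecution {n : ℕ} (F : Set (Fin n → ℤ)) (φ : (Fin n → ℤ) → ℚ)
    (S : Set (Fin n → ℤ)) (z : ℕ → Fin n → ℤ) (k : ℕ) : Prop :=
  IsGreedySequence F φ S z k ∧ ∀ i < k, ¬ IsGreedyVector F φ S (z i) 0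

/-- Encoding length of an integer: a sign and the binary digits. -/
def encInt (a : ℤ) : ℕ := 1 + Nat.size a.natAbs

/-- Encoding length of a rational number in lowest terms. -/
def encRat (a : ℚ) : ℕ := 1 + Nat.size a.num.natAbs + Nat.size a.den

/-- Encoding length of an integer vector. -/
def encVec {n : ℕ} (v : Fin n → ℤ) : ℕ := ∑ j, encInt (v j)

/-- Total encoding length of `A, u, b, c, c₁, …, cₛ`. -/
def encData {d n s : ℕ} (A : Matrix (Fin d) (Fin n) ℤ) (u : Fin n → ℤ) (b : Fin d → ℤ)
    (c : Fin n → ℚ) (C : Matrix (Fin s) (Fin n) ℚ) : ℕ :=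
  (∑ i, encVec (A i)) + encVec u + encVec b + (∑ j, encRat (c j)) + ∑ i, ∑ j, encRat (C i j)

/-! For feasible `x`, `y`, the vector `(y - x, C(x - y))` is an integer point of the kernel of the
block matrix in some orthant. Repeatedly subtracting the largest possible multiple of a Graver
element costs some entry a binary digit each time (`exists_graver_multiple_add`), so the vector is a
sum of at most `N` such multiples, where `N` is quadratic in the encoding length
(`bitSum_le_of_encData`).

Inside an orthant, separable convexity makes the objective change superadditive
(`ZConvex.add_le_add`). Hence one of these multiples gains at least `1 / N` of what `y` gains over
`x`, and adding it stays in the box between `x` and `y` (`exists_candidate_improving`). A greedy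
step does at least as well, so the gap to any feasible point shrinks by the factor `1 - 1 / N`.
Since objective values lie in `(1 / D)ℤ`, with `D` the product of the denominators of `c`, a gap
below `1 / D` means optimality (`HasFractionalSteps.isOptimal_of_le`). -/

/-! ### Graver bases and decompositions within an orthant -/

section Orthant

variable {κ ι : Type*} [Fintype ι]

/-- The integer points of `ker M` in an orthant, as a monoid. -/
def kerOrthantMonoid (M : Matrix κ ι ℚ) (σ : ι → ℤˣ) : AddSubmonoid (ι → ℤ) where
  carrier := kerOrthant M σ
  zero_mem' := by
    refine ⟨?_, fun j => by simp⟩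
    have : (fun j => (((0 : ι → ℤ) j : ℤ) : ℚ)) = 0 := by ext; simp
    rw [this, Matrix.mulVec_zero]
  add_mem' := by
    rintro a b ⟨ha, ha'⟩ ⟨hb, hb'⟩
    refine ⟨?_, fun j => ?_⟩
    · have : (fun j => (((a + b) j : ℤ) : ℚ)) = (fun j => (a j : ℚ)) + fun j => (b j : ℚ) := by
        ext; simp
      rw [this, Matrix.mulVec_add, ha, hb, add_zero]
    · rw [Pi.add_apply, mul_add]
      exact add_nonneg (ha' j) (hb' j)

theorem mem_kerOrthantMonoid {M : Matrix κ ι ℚ} {σ : ι → ℤˣ} {z : ι → ℤ} :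
    z ∈ kerOrthantMonoid M σ ↔
      M.mulVec (fun j => (z j : ℚ)) = 0 ∧ ∀ j, 0 ≤ (σ j : ℤ) * z j :=
  Iff.rfl

theorem sub_mem_kerOrthantMonoid {M : Matrix κ ι ℚ} {σ : ι → ℤˣ} {a b : ι → ℤ}
    (ha : a ∈ kerOrthantMonoid M σ) (hb : b ∈ kerOrthantMonoid M σ)
    (h : ∀ j, 0 ≤ (σ j : ℤ) * (a j - b j)) : a - b ∈ kerOrthantMonoid M σ := by
  refine ⟨?_, h⟩
  have : (fun j => (((a - b) j : ℤ) : ℚ)) = (fun j => (a j : ℚ)) - fun j => (b j : ℚ) := by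
    ext; simp
  rw [this, Matrix.mulVec_sub, ha.1, hb.1, sub_zero]

theorem natAbs_eq_sign_mul {M : Matrix κ ι ℚ} {σ : ι → ℤˣ} {z : ι → ℤ}
    (hz : z ∈ kerOrthantMonoid M σ) (j : ι) : ((z j).natAbs : ℤ) = (σ j : ℤ) * z j := by
  have h := hz.2 j
  rcases Int.units_eq_one_or (σ j) with e | e <;> rw [e] at h ⊢ <;> simp at h ⊢ <;> omega

/-- No cancellation occurs within an orthant. This drives every descent on `absSum` and `bitSum`. -/
theorem natAbs_add_of_mem {M : Matrix κ ι ℚ} {σ : ι → ℤˣ} {a b : ι → ℤ}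
    (ha : a ∈ kerOrthantMonoid M σ) (hb : b ∈ kerOrthantMonoid M σ) (j : ι) :
    ((a + b) j).natAbs = (a j).natAbs + (b j).natAbs := by
  have h := natAbs_eq_sign_mul (add_mem ha hb) j
  have h1 := natAbs_eq_sign_mul ha j
  have h2 := natAbs_eq_sign_mul hb j
  rw [Pi.add_apply, mul_add, ← h1, ← h2] at h
  exact_mod_cast h

/-- The sum of the absolute values of the entries. -/
def absSum (z : ι → ℤ) : ℕ := ∑ j, (z j).natAbs

theorem absSum_add_of_mem {M : Matrix κ ι ℚ} {σ : ι → ℤˣ} {a b : ι → ℤ}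
    (ha : a ∈ kerOrthantMonoid M σ) (hb : b ∈ kerOrthantMonoid M σ) :
    absSum (a + b) = absSum a + absSum b := by
  simp only [absSum, ← Finset.sum_add_distrib]
  exact Finset.sum_congr rfl fun j _ => natAbs_add_of_mem ha hb j

theorem absSum_pos {z : ι → ℤ} (hz : z ≠ 0) : 0 < absSum z := by
  obtain ⟨j, hj⟩ := Function.ne_iff.1 hz
  exact Finset.sum_pos' (fun _ _ => Nat.zero_le _)
    ⟨j, Finset.mem_univ _, Int.natAbs_pos.2 hj⟩

/-- The nonzero elements of a monoid that are not sums of two nonzero elements. -/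
def indecomposables {α : Type*} [AddCommMonoid α] (T : AddSubmonoid α) : Set α :=
  {g | g ∈ T ∧ g ≠ 0 ∧ ∀ a ∈ T, ∀ b ∈ T, g = a + b → a = 0 ∨ b = 0}

theorem exists_indecomposable_add {M : Matrix κ ι ℚ} {σ : ι → ℤˣ} :
    ∀ (N : ℕ) (v : ι → ℤ), absSum v ≤ N → v ∈ kerOrthantMonoid M σ → v ≠ 0 →
      ∃ g ∈ indecomposables (kerOrthantMonoid M σ), ∃ r ∈ kerOrthantMonoid M σ, v = g + r := by
  intro N
  induction N with
  | zero => exact fun v hN _ h0 => absurd hN (absSum_pos h0).not_ge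
  | succ N ih =>
    intro v hN hv h0
    by_cases h : v ∈ indecomposables (kerOrthantMonoid M σ)
    · exact ⟨v, h, 0, zero_mem _, (add_zero v).symm⟩
    · have : ∃ a ∈ kerOrthantMonoid M σ, ∃ b ∈ kerOrthantMonoid M σ, v = a + b ∧ a ≠ 0 ∧ b ≠ 0 := by
        by_contra hcon
        push Not at hcon
        exact h ⟨hv, h0, fun a ha b hb e => or_iff_not_imp_left.2 (hcon a ha b hb e)⟩
      obtain ⟨a, ha, b, hb, rfl, ha0, hb0⟩ := this
      have hb1 := absSum_pos hb0
      rw [absSum_add_of_mem ha hb] at hN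
      obtain ⟨g, hg, r, hr, rfl⟩ := ih a (by omega) ha ha0
      exact ⟨g, hg, r + b, add_mem hr hb, add_assoc _ _ _⟩

theorem mem_closure_indecomposables {M : Matrix κ ι ℚ} {σ : ι → ℤˣ} :
    ∀ (N : ℕ) (v : ι → ℤ), absSum v ≤ N → v ∈ kerOrthantMonoid M σ →
      v ∈ AddSubmonoid.closure (indecomposables (kerOrthantMonoid M σ)) := by
  intro N
  induction N with
  | zero =>
    intro v hN _
    by_cases h0 : v = 0
    · exact h0 ▸ zero_mem _
    · exact absurd hN (absSum_pos h0).not_ge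
  | succ N ih =>
    intro v hN hv
    by_cases h0 : v = 0
    · exact h0 ▸ zero_mem _
    · obtain ⟨g, hg, r, hr, rfl⟩ := exists_indecomposable_add _ v le_rfl hv h0
      have := absSum_pos hg.2.1
      rw [absSum_add_of_mem hg.1 hr] at hN
      exact add_mem (AddSubmonoid.subset_closure hg) (ih r (by omega) hr)

/-- Writing an indecomposable as a sum forces one summand to vanish, so the induction over the
closure always falls back on a generator. This gives minimality of the Hilbert basis. -/
theorem indecomposables_subset_of_closure_eq {α : Type*} [AddCommMonoid α] {T : AddSubmonoid α}
    {K : Set α} (hK : AddSubmonoid.closure K = T) : indecomposables T ⊆ K := by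
  rintro g ⟨hg, h0, hirr⟩
  have key : ∀ x (_ : x ∈ AddSubmonoid.closure K), x ∈ indecomposables T → x ∈ K := by
    intro x hx
    induction hx using AddSubmonoid.closure_induction with
    | mem x hx => exact fun _ => hx
    | zero => exact fun h => absurd rfl h.2.1
    | add a b ha hb iha ihb =>
      rintro h
      rcases h.2.2 a (hK ▸ ha) b (hK ▸ hb) rfl with rfl | rfl
      · rw [zero_add] at h ⊢
        exact ihb h
      · rw [add_zero] at h ⊢
        exact iha h
  exact key g (hK ▸ hg) ⟨hg, h0, hirr⟩

theorem isHilbertBasis_indecomposables (M : Matrix κ ι ℚ) (σ : ι → ℤˣ) :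
    IsHilbertBasis (kerOrthant M σ) (indecomposables (kerOrthantMonoid M σ)) := by
  constructor
  · refine Set.Subset.antisymm ?_ fun v hv => mem_closure_indecomposables _ v le_rfl hv
    exact (AddSubmonoid.closure_le (S := kerOrthantMonoid M σ)).2 fun g hg => hg.1
  · intro K hK _
    exact indecomposables_subset_of_closure_eq (T := kerOrthantMonoid M σ) (SetLike.coe_injective hK)

theorem indecomposables_subset_graverBasis (M : Matrix κ ι ℚ) (σ : ι → ℤˣ) :
    indecomposables (kerOrthantMonoid M σ) ⊆ graverBasis M :=
  fun _ hg => ⟨hg.2.1, σ, _, isHilbertBasis_indecomposables M σ, hg⟩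

/-- The total number of binary digits of the entries. -/
def bitSum (z : ι → ℤ) : ℕ := ∑ j, Nat.size (z j).natAbs

theorem size_lt_size_of_two_mul_lt {a b : ℕ} (h : 2 * a < b) : Nat.size a < Nat.size b := by
  rw [Nat.lt_size]
  by_cases h0 : a = 0
  · subst h0
    simpa [Nat.one_le_iff_ne_zero, Nat.pos_iff_ne_zero] using h
  · obtain ⟨k, hk⟩ : ∃ k, Nat.size a = k + 1 :=
      Nat.exists_eq_succ_of_ne_zero (Nat.size_pos.2 (Nat.pos_of_ne_zero h0)).ne'
    have : 2 ^ k ≤ a := Nat.lt_size.1 (by omega)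
    rw [hk, pow_succ]
    omega

/-- A nonzero element of the orthant monoid is the sum of a multiple of a Graver basis element and
of an element with fewer binary digits: the largest possible multiple halves some entry. -/
theorem exists_graver_multiple_add {M : Matrix κ ι ℚ} {σ : ι → ℤˣ} {v : ι → ℤ}
    (hv : v ∈ kerOrthantMonoid M σ) (h0 : v ≠ 0) :
    ∃ g ∈ graverBasis M, ∃ α : ℕ, α • g ∈ kerOrthantMonoid M σ ∧
      ∃ r ∈ kerOrthantMonoid M σ, v = α • g + r ∧ bitSum r < bitSum v := by
  classical
  obtain ⟨g, hg, r₀, hr₀, hv₀⟩ := exists_indecomposable_add _ v le_rfl hv h0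
  let P : ℕ → Prop := fun α => v - α • g ∈ kerOrthantMonoid M σ
  have hbound : ∀ α, P α → α ≤ absSum v := by
    intro α hα
    have h1 : absSum v = absSum (α • g) + absSum (v - α • g) := by
      rw [← absSum_add_of_mem (nsmul_mem hg.1 α) hα, add_sub_cancel]
    have h2 : absSum (α • g) = α * absSum g := by
      simp [absSum, Finset.mul_sum, Int.natAbs_mul]
    have h3 := absSum_pos hg.2.1
    nlinarith
  have hP1 : P 1 := by
    change v - 1 • g ∈ _
    rwa [one_smul, hv₀, add_sub_cancel_left]
  -- The largest multiple of `g` whose removal leaves `v` in the orthant.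
  set α := Nat.findGreatest P (absSum v) with hα
  have hPα : P α := Nat.findGreatest_spec (hbound 1 hP1) hP1
  have hα1 : 1 ≤ α := Nat.le_findGreatest (hbound 1 hP1) hP1
  have hmax : ¬ P (α + 1) := fun h => by
    have := Nat.le_findGreatest (hbound _ h) h
    omega
  have hαg := nsmul_mem hg.1 α
  have hsum : ∀ j, (v j).natAbs = α * (g j).natAbs + ((v - α • g) j).natAbs := by
    intro j
    have := natAbs_add_of_mem hαg hPα j
    rw [add_sub_cancel] at this
    rw [this]
    simp [Int.natAbs_mul]
  refine ⟨g, indecomposables_subset_graverBasis M σ hg, α, hαg, v - α • g, hPα,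
    (add_sub_cancel _ _).symm, ?_⟩
  -- If the remainder dominated `g` in every entry, one more copy of `g` could be removed. Where it
  -- does not, `|v j| ≥ |g j| + |r j| > 2 |r j|` for the remainder `r`, so a digit is lost.
  obtain ⟨j, hj⟩ : ∃ j, ((v - α • g) j).natAbs < (g j).natAbs := by
    by_contra hcon
    push Not at hcon
    apply hmax
    have : v - (α + 1) • g = (v - α • g) - g := by
      rw [add_smul, one_smul, sub_add_eq_sub_sub]
    change v - (α + 1) • g ∈ _
    rw [this]
    refine sub_mem_kerOrthantMonoid hPα hg.1 fun j => ?_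
    have h1 := natAbs_eq_sign_mul hPα j
    have h2 := natAbs_eq_sign_mul hg.1 j
    rw [mul_sub, ← h1, ← h2]
    have := hcon j
    omega
  refine Finset.sum_lt_sum (fun i _ => Nat.size_le_size ?_) ⟨j, Finset.mem_univ _,
    size_lt_size_of_two_mul_lt ?_⟩
  · rw [hsum i]
    exact Nat.le_add_left _ _
  · have := Nat.le_mul_of_pos_left (g j).natAbs hα1
    rw [hsum j]
    linarith

theorem eq_zero_of_bitSum_eq_zero {z : ι → ℤ} (h : bitSum z = 0) : z = 0 := by
  ext j
  have := (Finset.sum_eq_zero_iff.1 h) j (Finset.mem_univ _)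
  simpa [Nat.size_eq_zero] using this

/-- For a superadditive function on the orthant monoid, some multiple of a Graver basis element
below `v` achieves at least a fraction `1 / N` of the improvement of `v`. -/
theorem exists_graver_multiple_improving {M : Matrix κ ι ℚ} {σ : ι → ℤˣ} {Φ : (ι → ℤ) → ℚ}
    (hΦ : ∀ a ∈ kerOrthantMonoid M σ, ∀ b ∈ kerOrthantMonoid M σ, Φ a + Φ b ≤ Φ (a + b) + Φ 0) :
    ∀ (N : ℕ) (v : ι → ℤ), bitSum v ≤ N → v ∈ kerOrthantMonoid M σ →
      ∃ g ∈ insert 0 (graverBasis M), ∃ α : ℕ, α • g ∈ kerOrthantMonoid M σ ∧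
        v - α • g ∈ kerOrthantMonoid M σ ∧ N * (Φ (α • g) - Φ 0) ≤ Φ v - Φ 0 := by
  intro N
  induction N with
  | zero =>
    intro v hN hv
    obtain rfl := eq_zero_of_bitSum_eq_zero (Nat.le_zero.1 hN)
    exact ⟨0, Set.mem_insert _ _, 0, by simp, by simp, by simp⟩
  | succ N ih =>
    intro v hN hv
    by_cases h0 : v = 0
    · subst h0
      exact ⟨0, Set.mem_insert _ _, 0, by simp, by simp, by simp⟩
    obtain ⟨g, hg, α, hαg, r, hr, rfl, hlt⟩ := exists_graver_multiple_add hv h0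
    obtain ⟨g', hg', α', hαg', hr', hle⟩ := ih r (by omega) hr
    have hs := hΦ _ hαg _ hr
    push_cast
    -- Smaller `Φ` is better: the better of the new multiple and the one found for `r` reaches at
    -- least the average of `N + 1` gains.
    rcases le_total (Φ (α • g)) (Φ (α' • g')) with h | h
    · refine ⟨g, Set.mem_insert_of_mem _ hg, α, hαg, by simpa using hr, ?_⟩
      have : (N : ℚ) * (Φ (α • g) - Φ 0) ≤ N * (Φ (α' • g') - Φ 0) := by gcongr
      linarith
    · refine ⟨g', hg', α', hαg', ?_, by linarith⟩
      rw [add_sub_assoc]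
      exact add_mem hαg hr'

end Orthant

/-! ### Superadditivity of convex increments -/

/-- Both `a + x` and `a + y` are convex combinations of `a + (x + y)` and `a`, with the weights `x /
(x + y)` and `y / (x + y)` interchanged; equal signs make the weights nonnegative. -/
theorem ZConvex.add_le_add {g : ℤ → ℤ} (hg : ZConvex g) (a : ℤ) {x y : ℤ}
    (h : (0 ≤ x ∧ 0 ≤ y) ∨ (x ≤ 0 ∧ y ≤ 0)) : g (a + x) + g (a + y) ≤ g (a + (x + y)) + g a := by
  by_cases h0 : x + y = 0
  · have hx : x = 0 := by omega
    have hy : y = 0 := by omega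
    simp [hx, hy]
  have h0' : (x : ℝ) + y ≠ 0 := by exact_mod_cast h0
  have hfrac : ∀ s t : ℤ, ((0 ≤ s ∧ 0 ≤ t) ∨ (s ≤ 0 ∧ t ≤ 0)) → 0 ≤ (s : ℝ) / (s + t) := by
    rintro s t (⟨hs, ht⟩ | ⟨hs, ht⟩)
    · have : (0 : ℝ) ≤ s := by exact_mod_cast hs
      have : (0 : ℝ) ≤ t := by exact_mod_cast ht
      positivity
    · have h1 : (s : ℝ) ≤ 0 := by exact_mod_cast hs
      have h2 : (t : ℝ) ≤ 0 := by exact_mod_cast ht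
      exact div_nonneg_of_nonpos h1 (by linarith)
  have hx := hfrac x y h
  have hy := hfrac y x (by tauto)
  rw [add_comm (y : ℝ) x] at hy
  have hsum : (x : ℝ) / (x + y) + y / (x + y) = 1 := by field_simp
  have h1 := hg (a + (x + y)) a (a + x) (x / (x + y)) hx (by linarith)
    (by push_cast; field_simp; ring)
  have h2 := hg (a + (x + y)) a (a + y) (y / (x + y)) hy (by linarith)
    (by push_cast; field_simp; ring)
  have h3 : (1 : ℝ) - x / (x + y) = y / (x + y) := by linarith
  have h4 : (1 : ℝ) - y / (x + y) = x / (x + y) := by linarith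
  rw [h3] at h1
  rw [h4] at h2
  have : (g (a + x) : ℝ) + g (a + y) ≤ g (a + (x + y)) + g a := by
    calc (g (a + x) : ℝ) + g (a + y)
        ≤ (x / (x + y) + y / (x + y)) * g (a + (x + y)) + (x / (x + y) + y / (x + y)) * g a := by
          linarith
      _ = _ := by rw [hsum]; ring
  exact_mod_cast this

/-! ### Bounds from encoding lengths -/

section Encoding

theorem lt_two_pow_encInt (a : ℤ) : a.natAbs < 2 ^ encInt a :=
  (Nat.lt_size_self _).trans_le (Nat.pow_le_pow_right two_pos (Nat.le_add_left _ _))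

theorem natAbs_num_lt_two_pow_encRat (a : ℚ) : a.num.natAbs < 2 ^ encRat a :=
  (Nat.lt_size_self _).trans_le (Nat.pow_le_pow_right two_pos (by unfold encRat; omega))

theorem den_le_two_pow_encRat (a : ℚ) : a.den ≤ 2 ^ encRat a :=
  (Nat.lt_size_self _).le.trans (Nat.pow_le_pow_right two_pos (by unfold encRat; omega))

theorem abs_le_natAbs_num (a : ℚ) : |a| ≤ a.num.natAbs := by
  have h1 : (1 : ℚ) ≤ a.den := by exact_mod_cast a.pos
  have h2 : |a| * a.den = a.num.natAbs := by
    rw [Nat.cast_natAbs, Int.cast_abs, ← Rat.mul_den_eq_num, abs_mul, Nat.abs_cast]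
  nlinarith [abs_nonneg a]

theorem abs_lt_two_pow_encRat (a : ℚ) : |a| < 2 ^ encRat a :=
  (abs_le_natAbs_num a).trans_lt (by exact_mod_cast natAbs_num_lt_two_pow_encRat a)

/-- Follows from `(a + 1) * (b + 1) ≥ a + b + 1`. The extra `1` provides the strict inequality
needed to bound `Nat.size`. -/
theorem sum_add_one_le_two_pow_sum {ι : Type*} (J : Finset ι) (x : ι → ℕ) (e : ι → ℕ)
    (h : ∀ j ∈ J, x j < 2 ^ e j) : ∑ j ∈ J, x j + 1 ≤ 2 ^ ∑ j ∈ J, e j := by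
  classical
  induction J using Finset.induction_on with
  | empty => simp
  | insert a J ha ih =>
    rw [Finset.sum_insert ha, Finset.sum_insert ha, pow_add]
    have h1 := h a (Finset.mem_insert_self _ _)
    have h2 := ih fun j hj => h j (Finset.mem_insert_of_mem hj)
    have h3 : 1 ≤ 2 ^ ∑ j ∈ J, e j := Nat.one_le_two_pow
    nlinarith

theorem size_le_of_ratDot_eq {n : ℕ} {c : Fin n → ℚ} {z u : Fin n → ℤ} {w : ℤ}
    (hw : ratDot c z + w = 0) (hz : ∀ j, (z j).natAbs ≤ (u j).natAbs) :
    Nat.size w.natAbs ≤ ∑ j, (encRat (c j) + encInt (u j)) := by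
  rw [Nat.size_le]
  have h1 : (w.natAbs : ℚ) ≤ ∑ j, ((c j).num.natAbs * (z j).natAbs : ℕ) := by
    have : (w : ℚ) = -ratDot c z := by linarith
    rw [Nat.cast_natAbs, Int.cast_abs, this, abs_neg, Nat.cast_sum]
    refine (Finset.abs_sum_le_sum_abs _ _).trans (Finset.sum_le_sum fun j _ => ?_)
    rw [abs_mul, Nat.cast_mul, Nat.cast_natAbs (z j), Int.cast_abs]
    exact mul_le_mul_of_nonneg_right (abs_le_natAbs_num _) (abs_nonneg _)
  have h2 := sum_add_one_le_two_pow_sum Finset.univ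
    (fun j => (c j).num.natAbs * (z j).natAbs) (fun j => encRat (c j) + encInt (u j))
    fun j _ => by
      rw [pow_add]
      exact Nat.mul_lt_mul'' (natAbs_num_lt_two_pow_encRat _)
        ((hz j).trans_lt (lt_two_pow_encInt _))
  have h3 : w.natAbs ≤ ∑ j, ((c j).num.natAbs * (z j).natAbs) := by exact_mod_cast h1
  omega

variable {d n s : ℕ} (A : Matrix (Fin d) (Fin n) ℤ) (u : Fin n → ℤ) (b : Fin d → ℤ)
  (c : Fin n → ℚ) (C : Matrix (Fin s) (Fin n) ℚ)

theorem mul_le_sum_encRat : s * n ≤ ∑ i, ∑ j, encRat (C i j) := by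
  calc s * n = ∑ _i : Fin s, ∑ _j : Fin n, 1 := by simp
    _ ≤ _ := Finset.sum_le_sum fun i _ => Finset.sum_le_sum fun j _ => by unfold encRat; omega

/-- The quadratic term arises because each of the `s` slack entries may cost all digits of `u`; `s *
n` is bounded since every entry of `C` has positive encoding length. -/
theorem bitSum_le_of_encData {v : Fin n ⊕ Fin s → ℤ}
    (hv : ∀ i, ratDot (C i) (fun j => v (Sum.inl j)) + v (Sum.inr i) = 0)
    (hu : ∀ j, (v (Sum.inl j)).natAbs ≤ (u j).natAbs) :
    bitSum v ≤ 2 * encData A u b c C + encData A u b c C ^ 2 := by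
  have hlt : ∀ j, encInt (u j) ≤ encVec u := fun j =>
    Finset.single_le_sum (f := fun j => encInt (u j)) (fun _ _ => Nat.zero_le _)
      (Finset.mem_univ j)
  have h1 : ∑ j, Nat.size (v (Sum.inl j)).natAbs ≤ encVec u :=
    Finset.sum_le_sum fun j _ => (Nat.size_le_size (hu j)).trans (Nat.le_add_left _ _)
  have h2 : ∑ i, Nat.size (v (Sum.inr i)).natAbs ≤
      ∑ i, ∑ j, encRat (C i j) + s * n * encVec u := by
    calc ∑ i, Nat.size (v (Sum.inr i)).natAbs
        ≤ ∑ i, ∑ j, (encRat (C i j) + encInt (u j)) :=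
          Finset.sum_le_sum fun i _ => size_le_of_ratDot_eq (hv i) hu
      _ = ∑ i, ∑ j, encRat (C i j) + ∑ _i : Fin s, ∑ j, encInt (u j) := by
          simp only [Finset.sum_add_distrib]
      _ ≤ _ := by
          gcongr
          calc ∑ _i : Fin s, ∑ j, encInt (u j) ≤ ∑ _i : Fin s, ∑ _j : Fin n, encVec u :=
                Finset.sum_le_sum fun i _ => Finset.sum_le_sum fun j _ => hlt j
            _ = s * n * encVec u := by simp [mul_assoc]
  have h3 := mul_le_sum_encRat C
  have h4 : encVec u ≤ encData A u b c C := by unfold encData; omega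
  have h5 : ∑ i, ∑ j, encRat (C i j) ≤ encData A u b c C := by unfold encData; omega
  have h6 : s * n * encVec u ≤ encData A u b c C ^ 2 := by
    rw [pow_two]
    exact Nat.mul_le_mul (h3.trans h5) h4
  rw [bitSum, Fintype.sum_sum_type]
  omega

theorem prod_den_le_two_pow_encData : ∏ j, (c j).den ≤ 2 ^ encData A u b c C := by
  calc ∏ j, (c j).den ≤ ∏ j, 2 ^ encRat (c j) :=
        Finset.prod_le_prod' fun j _ => den_le_two_pow_encRat _
    _ = 2 ^ ∑ j, encRat (c j) := Finset.prod_pow_eq_pow_sum _ _ _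
    _ ≤ _ := Nat.pow_le_pow_right two_pos (by unfold encData; omega)

end Encoding

/-! ### The objective along kernel vectors -/

section Objective

variable {d n s : ℕ} {A : Matrix (Fin d) (Fin n) ℤ} {C : Matrix (Fin s) (Fin n) ℚ}

theorem ratDot_add (c : Fin n → ℚ) (x y : Fin n → ℤ) :
    ratDot c (x + y) = ratDot c x + ratDot c y := by
  simp [ratDot, mul_add, Finset.sum_add_distrib]

/-- The objective takes values in the multiples of the inverse of a common denominator. -/
theorem exists_objective_mul_prod_den (f : Fin s → ℤ → ℤ) (c : Fin n → ℚ) (z : Fin n → ℤ) :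
    ∃ m : ℤ, objective f c C z * ((∏ j, (c j).den : ℕ) : ℚ) = m := by
  have hc : ∀ j, ∃ m : ℤ, c j * ((∏ j, (c j).den : ℕ) : ℚ) = m := by
    intro j
    obtain ⟨t, ht⟩ := Finset.dvd_prod_of_mem (fun j => (c j).den) (Finset.mem_univ j)
    refine ⟨(c j).num * t, ?_⟩
    rw [ht]
    push_cast
    rw [← mul_assoc, Rat.mul_den_eq_num]
  choose m hm using hc
  refine ⟨(∑ i, f i ⌊ratDot (C i) z⌋) * (∏ j, (c j).den : ℕ) + ∑ j, m j * z j, ?_⟩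
  rw [objective, sepFun, ratDot, add_mul, Finset.sum_mul (f := fun j => c j * (z j : ℚ))]
  push_cast
  congr 1
  refine Finset.sum_congr rfl fun j _ => ?_
  rw [← hm j]
  push_cast
  ring

theorem mulVec_fromBlocks_one_eq_zero_iff {v : Fin n ⊕ Fin s → ℤ} :
    (Matrix.fromBlocks (A.map (Int.cast : ℤ → ℚ)) 0 C 1).mulVec (fun j => (v j : ℚ)) = 0 ↔
      A.mulVec (fun j => v (Sum.inl j)) = 0 ∧
        ∀ i, ratDot (C i) (fun j => v (Sum.inl j)) + v (Sum.inr i) = 0 := by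
  rw [Matrix.fromBlocks_mulVec, funext_iff, Sum.forall, funext_iff]
  simp only [Sum.elim_inl, Sum.elim_inr, Matrix.zero_mulVec, add_zero, Matrix.one_mulVec,
    Pi.add_apply, Pi.zero_apply, Function.comp_apply]
  refine and_congr (forall_congr' fun i => ?_) Iff.rfl
  rw [← Int.cast_inj (α := ℚ)]
  simp [Matrix.mulVec, dotProduct]

theorem exists_sign (v : ℤ) : ∃ σ : ℤˣ, 0 ≤ (σ : ℤ) * v := by
  rcases le_total 0 v with h | h
  · exact ⟨1, by simpa using h⟩
  · exact ⟨-1, by simpa using h⟩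

/-- From each feasible `x`, a candidate step achieves at least a fraction `1 / N` of the
improvement of any feasible `y`. -/
theorem exists_candidate_improving {b : Fin d → ℤ} {u : Fin n → ℤ} {c : Fin n → ℚ}
    {f : Fin s → ℤ → ℤ} (hf : ∀ i, ZConvex (f i))
    (hC : ∀ z ∈ feasibleSet A b u, ∀ i, ∃ m : ℤ, ratDot (C i) z = m)
    {N : ℕ} (hN : 2 * encData A u b c C + encData A u b c C ^ 2 ≤ N)
    {x y : Fin n → ℤ} (hx : x ∈ feasibleSet A b u) (hy : y ∈ feasibleSet A b u) :
    ∃ w, IsCandidate (feasibleSet A b u) (insert 0 (projGraverBasis A C)) x w ∧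
      N * (objective f c C (x + w) - objective f c C x) ≤
        objective f c C y - objective f c C x := by
  choose m hm using hC
  set M := Matrix.fromBlocks (A.map (Int.cast : ℤ → ℚ)) 0 C (1 : Matrix (Fin s) (Fin s) ℚ)
  let v : Fin n ⊕ Fin s → ℤ := Sum.elim (y - x) fun i => m x hx i - m y hy i
  have hAsub : A.mulVec (y - x) = 0 := by rw [Matrix.mulVec_sub, hx.1, hy.1, sub_self]
  have hCsub : ∀ i, ratDot (C i) (y - x) + ((m x hx i - m y hy i : ℤ) : ℚ) = 0 := by
    intro i
    have := ratDot_add (C i) x (y - x)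
    rw [add_sub_cancel, hm y hy, hm x hx] at this
    push_cast
    linarith
  choose σ hσ using fun j => exists_sign (v j)
  have hv : v ∈ kerOrthantMonoid M σ := ⟨mulVec_fromBlocks_one_eq_zero_iff.2 ⟨hAsub, hCsub⟩, hσ⟩
  have hbit : bitSum v ≤ N := by
    refine (bitSum_le_of_encData A u b c C hCsub fun j => ?_).trans hN
    have h1 : 0 ≤ x j := hx.2.1 j
    have h2 : x j ≤ u j := hx.2.2 j
    have h3 : 0 ≤ y j := hy.2.1 j
    have h4 : y j ≤ u j := hy.2.2 j
    change (y j - x j).natAbs ≤ _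
    omega
  -- The objective at `x` shifted by `a`, with the arguments of the `f i` read off the slack entries
  -- instead of through floors.
  let Φ : (Fin n ⊕ Fin s → ℤ) → ℚ := fun a =>
    ∑ i, (f i (m x hx i + -a (Sum.inr i)) : ℚ) + ratDot c (x + fun j => a (Sum.inl j))
  have hΦ : ∀ a ∈ kerOrthantMonoid M σ, ∀ b ∈ kerOrthantMonoid M σ,
      Φ a + Φ b ≤ Φ (a + b) + Φ 0 := by
    intro a ha b hb
    have h1 : ∀ i, (f i (m x hx i + -a (Sum.inr i)) : ℚ) + f i (m x hx i + -b (Sum.inr i)) ≤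
        f i (m x hx i + -(a + b) (Sum.inr i)) + f i (m x hx i + -(0 : Fin n ⊕ Fin s → ℤ) (Sum.inr i)) := by
      intro i
      have ha' := ha.2 (Sum.inr i)
      have hb' := hb.2 (Sum.inr i)
      have := (hf i).add_le_add (m x hx i) (x := -a (Sum.inr i)) (y := -b (Sum.inr i)) (by
        rcases Int.units_eq_one_or (σ (Sum.inr i)) with e | e <;> rw [e] at ha' hb' <;>
          simp at ha' hb' ⊢ <;> omega)
      rw [Pi.add_apply, neg_add, Pi.zero_apply, neg_zero, add_zero]
      exact_mod_cast this
    have h2 := Finset.sum_le_sum fun i (_ : i ∈ Finset.univ) => h1 i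
    simp only [Finset.sum_add_distrib] at h2
    have h3 : ratDot c (x + fun j => a (Sum.inl j)) + ratDot c (x + fun j => b (Sum.inl j)) =
        ratDot c (x + fun j => (a + b) (Sum.inl j)) +
          ratDot c (x + fun j => (0 : Fin n ⊕ Fin s → ℤ) (Sum.inl j)) := by
      simp only [ratDot, ← Finset.sum_add_distrib]
      refine Finset.sum_congr rfl fun j _ => ?_
      simp only [Pi.add_apply, Pi.zero_apply]
      push_cast
      ring
    simp only [Φ]
    linarith
  have hobj : ∀ a ∈ kerOrthantMonoid M σ, Φ a = objective f c C (x + fun j => a (Sum.inl j)) := by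
    intro a ha
    have h1 := (mulVec_fromBlocks_one_eq_zero_iff.1 ha.1).2
    simp only [Φ, objective, sepFun]
    congr 1
    refine Finset.sum_congr rfl fun i _ => ?_
    -- The shifted point need not be feasible; integrality comes from the integer slack entry of
    -- `a`.
    have : ratDot (C i) (x + fun j => a (Sum.inl j)) = ((m x hx i + -a (Sum.inr i) : ℤ) : ℚ) := by
      rw [ratDot_add, hm x hx i]
      have := h1 i
      push_cast
      linarith
    rw [this, Int.floor_intCast]
  obtain ⟨g, hg, α, hαg, hr, hle⟩ := exists_graver_multiple_improving hΦ N v hbit hv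
  have hvobj : Φ v = objective f c C y := by
    rw [hobj v hv]
    congr 1
    exact add_sub_cancel x y
  have h0obj : Φ 0 = objective f c C x := by
    rw [hobj 0 (zero_mem _)]
    congr 1
    exact add_zero x
  rw [hvobj, h0obj, hobj _ hαg] at hle
  refine ⟨fun j => (α • g) (Sum.inl j), ⟨⟨α, Nat.cast_nonneg α, fun j => g (Sum.inl j), ?_, ?_⟩,
    ?_, ?_⟩, hle⟩
  · rcases hg with rfl | hg
    · exact Set.mem_insert _ _
    · exact Set.mem_insert_of_mem _ ⟨g, hg, rfl⟩
  · intro j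
    simp
  · rw [Matrix.mulVec_add, hx.1, (mulVec_fromBlocks_one_eq_zero_iff.1 hαg.1).1, add_zero]
  -- As `α • g` and `v - α • g` share the orthant of `v`, the new point lies coordinatewise between
  -- `x` and `y`.
  · have key : ∀ j, 0 ≤ (x j + (α • g) (Sum.inl j)) ∧ (x j + (α • g) (Sum.inl j)) ≤ u j := by
      intro j
      have h1 : 0 ≤ x j := hx.2.1 j
      have h2 : x j ≤ u j := hx.2.2 j
      have h3 : 0 ≤ y j := hy.2.1 j
      have h4 : y j ≤ u j := hy.2.2 j
      have h5 := hαg.2 (Sum.inl j)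
      have h6 := hr.2 (Sum.inl j)
      have h7 : (v - α • g) (Sum.inl j) = y j - x j - (α • g) (Sum.inl j) := rfl
      rw [h7] at h6
      rcases Int.units_eq_one_or (σ (Sum.inl j)) with e | e <;> rw [e] at h5 h6 <;>
        simp only [Units.val_one, one_mul, Units.val_neg, neg_mul] at h5 h6 <;> omega
    exact ⟨fun j => (key j).1, fun j => (key j).2⟩

end Objective

/-! ### Convergence of greedy augmentation -/

section Greedy

variable {n : ℕ} {F S : Set (Fin n → ℤ)} {φ : (Fin n → ℤ) → ℚ}

theorem finite_feasibleSet {d : ℕ} (A : Matrix (Fin d) (Fin n) ℤ) (b : Fin d → ℤ)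
    (u : Fin n → ℤ) : (feasibleSet A b u).Finite :=
  (Set.finite_Icc 0 u).subset fun _ hz => hz.2

theorem IsCandidate.zero (hS : 0 ∈ S) {z : Fin n → ℤ} (hz : z ∈ F) : IsCandidate F S z 0 :=
  ⟨⟨0, le_rfl, 0, hS, fun j => by simp⟩, by rwa [add_zero]⟩

theorem exists_isGreedyVector (hF : F.Finite) (hS : 0 ∈ S) {z : Fin n → ℤ} (hz : z ∈ F) :
    ∃ v, IsGreedyVector F φ S z v := by
  -- Although `α` is real, candidates lie in a translate of the finite set `F`.
  have hfin : {v | IsCandidate F S z v}.Finite :=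
    (hF.preimage (add_right_injective z).injOn).subset fun v hv => hv.2
  obtain ⟨v, hv, hmin⟩ := Set.exists_min_image _ (fun v => φ (z + v)) hfin
    ⟨0, IsCandidate.zero hS hz⟩
  exact ⟨v, hv, hmin⟩

theorem IsOptimal.isGreedyVector_zero (hS : 0 ∈ S) {z : Fin n → ℤ} (hz : IsOptimal F φ z) :
    IsGreedyVector F φ S z 0 :=
  ⟨IsCandidate.zero hS hz.1, fun w hw => by simpa using hz.2 _ hw.2⟩

theorem IsGreedySequence.mono {z : ℕ → Fin n → ℤ} {k l : ℕ} (h : IsGreedySequence F φ S z k)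
    (hl : l ≤ k) : IsGreedySequence F φ S z l :=
  fun i hi => h i (hi.trans_le hl)

theorem IsGreedySequence.mem {z : ℕ → Fin n → ℤ} {k : ℕ} (h : IsGreedySequence F φ S z k)
    (h0 : z 0 ∈ F) : ∀ i ≤ k, z i ∈ F := by
  rintro (_ | i) hi
  · exact h0
  · obtain ⟨v, hv, e⟩ := h i hi
    exact e ▸ hv.1.2

/-- Every candidate set contains a step achieving a fraction `1 / N` of any improvement. -/
def HasFractionalSteps (F S : Set (Fin n → ℤ)) (φ : (Fin n → ℤ) → ℚ) (N : ℕ) : Prop :=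
  ∀ x ∈ F, ∀ y ∈ F, ∃ w, IsCandidate F S x w ∧ N * (φ (x + w) - φ x) ≤ φ y - φ x

theorem HasFractionalSteps.isOptimal {N : ℕ} (h : HasFractionalSteps F S φ N) {z : Fin n → ℤ}
    (hz : z ∈ F) (hg : IsGreedyVector F φ S z 0) : IsOptimal F φ z := by
  refine ⟨hz, fun y hy => ?_⟩
  obtain ⟨w, hw, hle⟩ := h z hz y hy
  have := hg.2 w hw
  rw [add_zero] at this
  have : (0 : ℚ) ≤ N * (φ (z + w) - φ z) := mul_nonneg (Nat.cast_nonneg _) (by linarith)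
  linarith

theorem HasFractionalSteps.gap_le {N : ℕ} (hN : 0 < N) (h : HasFractionalSteps F S φ N)
    {z : ℕ → Fin n → ℤ} {y : Fin n → ℤ} (h0 : z 0 ∈ F) (hy : y ∈ F) :
    ∀ k, IsGreedySequence F φ S z k →
      φ (z k) - φ y ≤ (1 - 1 / (N : ℚ)) ^ k * (φ (z 0) - φ y) := by
  have hN' : (1 : ℚ) ≤ N := by exact_mod_cast hN
  have hr : (0 : ℚ) ≤ 1 - 1 / N := by
    rw [sub_nonneg, div_le_one (by linarith)]
    exact hN'
  intro k
  induction k with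
  | zero => simp
  | succ k ih =>
    intro hk
    have hk' := hk.mono k.le_succ
    obtain ⟨v, hv, e⟩ := hk k k.lt_succ_self
    obtain ⟨w, hw, hle⟩ := h (z k) (hk'.mem h0 k le_rfl) y hy
    have h1 := hv.2 w hw
    rw [← e] at h1
    have h2 : φ (z k + w) - φ (z k) ≤ (φ y - φ (z k)) / N := by
      rw [le_div_iff₀ (by linarith)]
      linarith
    calc φ (z (k + 1)) - φ y ≤ (1 - 1 / (N : ℚ)) * (φ (z k) - φ y) := by
          have : (1 - 1 / (N : ℚ)) * (φ (z k) - φ y) =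
            φ (z k) - φ y + (φ y - φ (z k)) / N := by ring
          linarith
      _ ≤ (1 - 1 / (N : ℚ)) * ((1 - 1 / (N : ℚ)) ^ k * (φ (z 0) - φ y)) :=
          mul_le_mul_of_nonneg_left (ih hk') hr
      _ = _ := by ring

/-- Every `N` steps halve the gap: `(1 + 1 / N) ^ N ≥ 2` by Bernoulli and `(1 - 1 / N) * (1 + 1 / N)
≤ 1`. -/
theorem one_sub_inv_pow_mul_le {N : ℕ} (hN : 0 < N) {t k : ℕ} (hk : N * t ≤ k) :
    (1 - 1 / (N : ℚ)) ^ k * 2 ^ t ≤ 1 := by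
  have hN' : (1 : ℚ) ≤ N := by exact_mod_cast hN
  have hinv : (0 : ℚ) ≤ 1 / N := by positivity
  have hinv' : 1 / (N : ℚ) ≤ 1 := (div_le_one (by linarith)).2 hN'
  have hr : (0 : ℚ) ≤ 1 - 1 / N := by linarith
  have h2 : (2 : ℚ) ≤ (1 + 1 / (N : ℚ)) ^ N := by
    have := one_add_mul_le_pow (a := 1 / (N : ℚ)) (by linarith) N
    rwa [mul_one_div_cancel (by linarith), one_add_one_eq_two] at this
  calc (1 - 1 / (N : ℚ)) ^ k * 2 ^ t
      ≤ (1 - 1 / (N : ℚ)) ^ (N * t) * ((1 + 1 / (N : ℚ)) ^ N) ^ t :=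
        mul_le_mul (pow_le_pow_of_le_one hr (by linarith) hk) (pow_le_pow_left₀ zero_le_two h2 t)
          (by positivity) (pow_nonneg hr _)
    _ = ((1 - 1 / (N : ℚ)) * (1 + 1 / N)) ^ (N * t) := by rw [← pow_mul, mul_pow]
    _ ≤ 1 := pow_le_one₀ (mul_nonneg hr (by linarith)) (by nlinarith)

/-- After `N * t` greedy steps the current point is optimal, if the initial gap is less than
`2 ^ t / D` and the values of `φ` are multiples of `1 / D`. -/
theorem HasFractionalSteps.isOptimal_of_le {N : ℕ} (hN : 0 < N) (h : HasFractionalSteps F S φ N)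
    {z : ℕ → Fin n → ℤ} (h0 : z 0 ∈ F) {D t k : ℕ}
    (hD0 : 0 < D) (hD : ∀ x, ∃ m : ℤ, φ x * D = m) (hgap : ∀ y ∈ F, (φ (z 0) - φ y) * D < 2 ^ t)
    (hk : N * t ≤ k) (hz : IsGreedySequence F φ S z k) : IsOptimal F φ (z k) := by
  refine ⟨hz.mem h0 k le_rfl, fun y hy => ?_⟩
  by_contra hlt
  push Not at hlt
  obtain ⟨m₁, hm₁⟩ := hD (z k)
  obtain ⟨m₂, hm₂⟩ := hD y
  have hD' : (0 : ℚ) < D := by exact_mod_cast hD0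
  have hpos : 0 < (φ (z k) - φ y) * D := mul_pos (by linarith) hD'
  have hint : (φ (z k) - φ y) * D = ((m₁ - m₂ : ℤ) : ℚ) := by
    rw [sub_mul, hm₁, hm₂, Int.cast_sub]
  have hone : 1 ≤ (φ (z k) - φ y) * D := by
    rw [hint] at hpos ⊢
    have : 0 < m₁ - m₂ := by exact_mod_cast hpos
    exact_mod_cast this
  have h1 := h.gap_le hN h0 hy k hz
  have hr := one_sub_inv_pow_mul_le hN hk
  -- A negative initial gap would stay nonpositive, contradicting `hlt`.
  have hg0 : 0 ≤ φ (z 0) - φ y := by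
    by_contra hneg
    push Not at hneg
    have : (0 : ℚ) ≤ (1 - 1 / (N : ℚ)) ^ k := by
      refine pow_nonneg (sub_nonneg.2 ((div_le_one (by exact_mod_cast hN)).2 ?_)) k
      exact_mod_cast hN
    have := mul_nonpos_of_nonneg_of_nonpos this hneg.le
    linarith
  have h2 : (φ (z k) - φ y) * D * 2 ^ t ≤ (φ (z 0) - φ y) * D := by
    calc (φ (z k) - φ y) * D * 2 ^ t
        ≤ (1 - 1 / (N : ℚ)) ^ k * (φ (z 0) - φ y) * D * 2 ^ t := by gcongr
      _ = (φ (z 0) - φ y) * D * ((1 - 1 / (N : ℚ)) ^ k * 2 ^ t) := by ring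
      _ ≤ _ := mul_le_of_le_one_right (mul_nonneg hg0 hD'.le) hr
  have h3 : (2 : ℚ) ^ t ≤ (φ (z k) - φ y) * D * 2 ^ t := le_mul_of_one_le_left (by positivity) hone
  exact absurd (hgap y hy) (h3.trans h2).not_gt

theorem exists_greedy_trajectory (hF : F.Finite) (hS : 0 ∈ S) {z₀ : Fin n → ℤ} (h0 : z₀ ∈ F) :
    ∃ z : ℕ → Fin n → ℤ, z 0 = z₀ ∧ ∀ k, IsGreedySequence F φ S z k := by
  choose v hv using fun z : F => exists_isGreedyVector (φ := φ) hF hS z.2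
  let z : ℕ → F := fun k => (fun x : F => (⟨x + v x, (hv x).1.2⟩ : F))^[k] ⟨z₀, h0⟩
  refine ⟨fun k => z k, rfl, fun k i _ => ⟨v (z i), hv (z i), ?_⟩⟩
  simp only [z, Function.iterate_succ_apply']

end Greedy

/-! ### The polynomial bound on the number of steps -/

theorem eval_le_eval_of_le (p : Polynomial ℕ) {a b : ℕ} (h : a ≤ b) : p.eval a ≤ p.eval b := by
  rw [Polynomial.eval_eq_sum, Polynomial.eval_eq_sum]
  exact Finset.sum_le_sum fun i _ => Nat.mul_le_mul_left _ (Nat.pow_le_pow_left h i)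

theorem theorem2 (p : Polynomial ℕ) :
    ∃ q : Polynomial ℕ,
      ∀ (d n s : ℕ) (A : Matrix (Fin d) (Fin n) ℤ) (u : Fin n → ℤ) (b : Fin d → ℤ)
        (c : Fin n → ℚ) (C : Matrix (Fin s) (Fin n) ℚ) (f : Fin s → ℤ → ℤ) (H : ℚ)
        (F S : Set (Fin n → ℤ)) (φ : (Fin n → ℤ) → ℚ),
        F = feasibleSet A b u →
        S = insert 0 (projGraverBasis A C) →
        φ = objective f c C →
        (∀ i, ZConvex (f i)) →
        (∀ z ∈ F, ∀ i, ∃ m : ℤ, ratDot (C i) z = m) →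
        (∀ x ∈ F, ∀ y ∈ F, φ x - φ y ≤ H) →
        encRat H ≤ p.eval (encData A u b c C) →
        ∀ z₀ ∈ F,
          -- some execution is completed, and it ends at an optimal solution
          (∃ (k : ℕ) (z : ℕ → Fin n → ℤ), z 0 = z₀ ∧ IsGreedyExecution F φ S z k ∧
            IsGreedyVector F φ S (z k) 0 ∧ IsOptimal F φ (z k)) ∧
          -- every execution performs only polynomially many augmentation steps
          (∀ (k : ℕ) (z : ℕ → Fin n → ℤ), z 0 = z₀ → IsGreedyExecution F φ S z k →
            k ≤ q.eval (encData A u b c C + encVec z₀)) ∧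
          -- whatever greedy choices are made: there is always a next one, `0` is only chosen
          -- at an optimal solution, and optimality holds after polynomially many steps
          (∀ (k : ℕ) (z : ℕ → Fin n → ℤ), z 0 = z₀ → IsGreedySequence F φ S z k →
            (∃ v, IsGreedyVector F φ S (z k) v) ∧
            (IsGreedyVector F φ S (z k) 0 → IsOptimal F φ (z k)) ∧
            (q.eval (encData A u b c C + encVec z₀) ≤ k → IsOptimal F φ (z k))) := by
  -- The first factor is `N`, kept positive by the `1`. In the second, `p` bounds the binary
  -- logarithm of the initial gap and `X` that of the common denominator.
  refine ⟨(2 * Polynomial.X + Polynomial.X ^ 2 + 1) * (p + Polynomial.X), ?_⟩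
  intro d n s A u b c C f H F S φ hF hS hφ hf hC hH hHp z₀ hz₀
  set L := encData A u b c C
  set q := Polynomial.eval (L + encVec z₀)
    ((2 * Polynomial.X + Polynomial.X ^ 2 + 1) * (p + Polynomial.X)) with hq
  have hFfin : F.Finite := hF ▸ finite_feasibleSet A b u
  have hS0 : 0 ∈ S := hS ▸ Set.mem_insert _ _
  have hfrac : HasFractionalSteps F S φ (2 * L + L ^ 2 + 1) := by
    subst hF hS hφ
    exact fun x hx y hy => exists_candidate_improving hf hC (Nat.le_succ _) hx hy
  have hqle : (2 * L + L ^ 2 + 1) * (p.eval L + L) ≤ q := by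
    have h := eval_le_eval_of_le ((2 * Polynomial.X + Polynomial.X ^ 2 + 1) * (p + Polynomial.X))
      (Nat.le_add_right L (encVec z₀))
    simpa [hq] using h
  have hgap : ∀ y ∈ F, (φ z₀ - φ y) * ((∏ j, (c j).den : ℕ) : ℚ) < 2 ^ (p.eval L + L) := by
    intro y hy
    have h1 : φ z₀ - φ y < 2 ^ p.eval L := by
      calc φ z₀ - φ y ≤ |H| := (hH _ hz₀ _ hy).trans (le_abs_self H)
        _ < 2 ^ encRat H := abs_lt_two_pow_encRat H
        _ ≤ _ := pow_le_pow_right₀ one_le_two hHp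
    have h2 : ((∏ j, (c j).den : ℕ) : ℚ) ≤ 2 ^ L := by
      exact_mod_cast prod_den_le_two_pow_encData A u b c C
    have h3 : (0 : ℚ) < ((∏ j, (c j).den : ℕ) : ℚ) := by
      exact_mod_cast Finset.prod_pos fun j _ => (c j).pos
    rw [pow_add]
    exact mul_lt_mul h1 h2 h3 (by positivity)
  have hopt : ∀ (k : ℕ) (z : ℕ → Fin n → ℤ), z 0 = z₀ → IsGreedySequence F φ S z k → q ≤ k →
      IsOptimal F φ (z k) := by
    rintro k z rfl hz hk
    refine hfrac.isOptimal_of_le (Nat.succ_pos _) hz₀ (Finset.prod_pos fun j _ => (c j).pos)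
      (fun x => ?_) hgap (hqle.trans hk) hz
    rw [hφ]
    exact exists_objective_mul_prod_den f c x
  refine ⟨?_, ?_, ?_⟩
  · classical
    obtain ⟨z, hz0, hz⟩ := exists_greedy_trajectory (φ := φ) hFfin hS0 hz₀
    have hex : ∃ k, IsGreedyVector F φ S (z k) 0 :=
      ⟨q, (hopt q z hz0 (hz q) le_rfl).isGreedyVector_zero hS0⟩
    refine ⟨Nat.find hex, z, hz0, ⟨hz _, fun i hi => Nat.find_min hex hi⟩, Nat.find_spec hex, ?_⟩
    exact hfrac.isOptimal ((hz _).mem (hz0 ▸ hz₀) _ le_rfl) (Nat.find_spec hex)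
  · intro k z hz0 hz
    by_contra hlt
    push Not at hlt
    -- The point after `q` steps is optimal, so `0` is greedy there and the execution would already
    -- have stopped.
    exact hz.2 q hlt ((hopt q z hz0 (hz.1.mono hlt.le) le_rfl).isGreedyVector_zero hS0)
  · intro k z hz0 hz
    have hmem := hz.mem (hz0 ▸ hz₀) k le_rfl
    exact ⟨exists_isGreedyVector hFfin hS0 hmem, hfrac.isOptimal hmem, hopt k z hz0 hz⟩
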